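/- Let $T$ be a compact metric space, let $t\mapsto a_t\in\mathbb{R}^n$ be a continuous map on $T$, and let $\mathbb{R}^n$ be equipped with an arbitrary norm $\|\cdot\|$, with dual norm $\|u\|_*=\max_{\|x\|\le 1}|u'x|$. Let $C(T,\mathbb{R})$ carry the supremum norm, and consider the feasible set mapping $\mathcal{F}:C(T,\mathbb{R})\rightrightarrows\mathbb{R}^n$, $\mathcal{F}(b)=\{x\in\mathbb{R}^n : a_t'x\le b_t \text{ for all } t\in T\}$. Its global Hoffman constant $\operatorname{Hof}\mathcal{F}\in[0,+\infty]$ is the infimum of all constants $\kappa\ge 0$ such that $$d(x,\mathcal{F}(b))\le \kappa\, d(b,\mathcal{F}^{-1}(x))\quad\text{for all } x\in\mathbb{R}^n \text{ and all } b\in C(T,\mathbb{R}) \text{ with } \mathcal{F}(b)\neq\emptyset,$$ where $\mathcal{F}^{-1}(x)=\{b : x\in\mathcal{F}(b)\}$, $d(z,S)=\inf_{s\in S}\|z-s\|$ in the respective space, and $\inf\emptyset=+\infty$. Then $$\operatorname{Hof}\mathcal{F}=\sup\Big\{ d_*\big(0_n,\operatorname{conv}\{a_t : t\in J\}\big)^{-1}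 \;:\; J\subset T \text{ compact},\ 0_n\notin\operatorname{conv}\{a_t : t\in J\}\Big\},$$ as an equality in $[0,+\infty]$, where $d_*(0_n,C)=\inf_{u\in C}\|u\|_*$. The set $J=\emptyset$ is allowed and contributes $d_*(0_n,\emptyset)^{-1}=(+\infty)^{-1}=0$. -/

import Mathlib

open scoped NNReal ENNReal

/-- A norm on `ℝⁿ = (Fin n → ℝ)`: a seminorm that vanishes only at `0`. -/
structure RnNorm (n : ℕ) extends Seminorm ℝ (Fin n → ℝ) where
  eq_zero_of_map_eq_zero' : ∀ x, toFun x = 0 → x = 0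

/-- The space `ℝⁿ` equipped with the norm `N` (a copy of `Fin n → ℝ` that does not carry the
default sup norm). -/
def RnWith {n : ℕ} (_N : RnNorm n) : Type := Fin n → ℝ

namespace RnWith

variable {n : ℕ} (N : RnNorm n)

instance : AddCommGroup (RnWith N) := inferInstanceAs (AddCommGroup (Fin n → ℝ))

instance : Module ℝ (RnWith N) := inferInstanceAs (Module ℝ (Fin n → ℝ))

/-- The vector of coordinates. -/
def coords {N : RnNorm n} (x : RnWith N) : Fin n → ℝ := x

noncomputable instance : NormedAddCommGroup (RnWith N) :=
  AddGroupNorm.toNormedAddCommGroup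
    { toFun := fun x : RnWith N => N.toSeminorm x.coords
      map_zero' := map_zero N.toSeminorm
      add_le' := fun x y => map_add_le_add N.toSeminorm x.coords y.coords
      neg' := fun x => map_neg_eq_map N.toSeminorm x.coords
      eq_zero_of_map_eq_zero' := fun x hx => N.eq_zero_of_map_eq_zero' x.coords hx }

theorem norm_def {N : RnNorm n} (x : RnWith N) : ‖x‖ = N.toSeminorm x.coords := rfl

noncomputable instance : NormedSpace ℝ (RnWith N) where
  norm_smul_le c x := (map_smul_eq_mul N.toSeminorm c x.coords).le

end RnWith

/-- The dual norm `‖u‖_* = max { |u'x| : ‖x‖ ≤ 1 }` on `ℝⁿ`, as an element of `[0, ∞]`. -/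
noncomputable def dualNorm {n : ℕ} (N : RnNorm n) (u : Fin n → ℝ) : ℝ≥0∞ :=
  ⨆ x : RnWith N, ⨆ _ : ‖x‖ ≤ 1, ENNReal.ofReal |u ⬝ᵥ x.coords|

/-- The distance `d_*(v, C) = inf { ‖v - u‖_* : u ∈ C }` for the dual norm, with
`d_*(v, ∅) = ∞`. -/
noncomputable def dualDist {n : ℕ} (N : RnNorm n) (v : Fin n → ℝ) (C : Set (Fin n → ℝ)) : ℝ≥0∞ :=
  ⨅ u ∈ C, dualNorm N (v - u)

/-- `κ` is a (global) Hoffman constant for the multifunction `M : Y ⇉ X`: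
`d(x, M(y)) ≤ κ d(y, M⁻¹(x))` for all `x ∈ X` and all `y ∈ dom M`.
Here `Metric.infEDist` is the point-to-set distance, equal to `∞` for the empty set. -/
def IsHoffmanConstant {Y X : Type*} [MetricSpace Y] [MetricSpace X] (M : Y → Set X) (κ : ℝ≥0) :
    Prop :=
  ∀ x : X, ∀ y : Y, (M y).Nonempty →
    Metric.infEDist x (M y) ≤ (κ : ℝ≥0∞) * Metric.infEDist y {z : Y | x ∈ M z}

/-- The global Hoffman constant `Hof M ∈ [0, ∞]` of `M : Y ⇉ X`: the infimum of all its Hoffman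
constants (`∞` if there are none). -/
noncomputable def globalHoffman {Y X : Type*} [MetricSpace Y] [MetricSpace X] (M : Y → Set X) :
    ℝ≥0∞ :=
  ⨅ κ : ℝ≥0, ⨅ _ : IsHoffmanConstant M κ, (κ : ℝ≥0∞)

/-- The feasible set mapping `F(b) = { x ∈ ℝⁿ : a_t'x ≤ b_t, t ∈ T }`, where `C(T, ℝ)` carries the
supremum norm and `ℝⁿ` carries the norm `N`. -/
def feasibleSet {n : ℕ} (N : RnNorm n) {T : Type*} [TopologicalSpace T] (a : T → Fin n → ℝ)
    (b : C(T, ℝ)) : Set (RnWith N) :=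
  {x | ∀ t : T, a t ⬝ᵥ x.coords ≤ b t}

/-! Lower bound: if `0` is not in the hull of the gradients over `J`, some `d` has `a t ⬝ᵥ d ≤ -1`
on `J`. For `b t = max (-1) (a t ⬝ᵥ d)`, `d` is feasible and `b` is within `1` of the parameters
admitting `0`. A feasible `x` satisfies `u ⬝ᵥ x ≤ -1` for every `u` in the hull, so its norm is at
least the inverse dual distance.

Upper bound: if the `ρ`-ball around `x` misses the feasible set, compactness and Hahn–Banach give a
convex combination of finitely many constraints, with gradient `u`, violated on the whole ball.
Moving `ρ` along unit vectors gives `ρ‖u‖_* ≤ d(b, F⁻¹(x))`. The crux is to prune the support until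
`0` leaves the hull of its gradients, so that it is an admissible `J`; this is where feasibility of
`b` enters. -/

section ConvexGeometry

/-- In a finite-dimensional space the convex hull of a compact set is compact. -/
theorem IsCompact.isCompact_convexHull_of_finiteDimensional {E : Type*} [NormedAddCommGroup E]
    [NormedSpace ℝ E] [FiniteDimensional ℝ E] {s : Set E} (hs : IsCompact s) :
    IsCompact (convexHull ℝ s) := by
  have join : ∀ k : Set E, IsCompact k → IsCompact (convexJoin ℝ s k) := by
    intro k hk
    have hc : IsCompact ((fun p : ℝ × E × E => (1 - p.1) • p.2.1 + p.1 • p.2.2) ''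
        (Set.Icc (0 : ℝ) 1 ×ˢ s ×ˢ k)) :=
      (isCompact_Icc.prod (hs.prod hk)).image (by fun_prop)
    convert hc using 1
    ext x
    simp only [mem_convexJoin, segment_eq_image, Set.mem_image, Set.mem_prod, Prod.exists]
    constructor
    · rintro ⟨y, hy, z, hz, θ, hθ, rfl⟩
      exact ⟨θ, y, z, ⟨hθ, hy, hz⟩, rfl⟩
    · rintro ⟨θ, y, z, ⟨hθ, hy, hz⟩, rfl⟩
      exact ⟨y, hy, z, hz, θ, hθ, rfl⟩
  have key : ∀ m : ℕ, ∃ k : Set E, IsCompact k ∧ k ⊆ convexHull ℝ s ∧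
      ∀ t : Finset E, (t : Set E) ⊆ s → t.card ≤ m → convexHull ℝ (t : Set E) ⊆ k := by
    intro m
    induction m with
    | zero =>
      refine ⟨∅, isCompact_empty, Set.empty_subset _, fun t _ ht => ?_⟩
      have : t = ∅ := by simpa using ht
      simp [this]
    | succ m ih =>
      obtain ⟨k, hk, hks, hkt⟩ := ih
      refine ⟨s ∪ convexJoin ℝ s k, hs.union (join k hk), Set.union_subset (subset_convexHull ℝ s)
        (convexJoin_subset (subset_convexHull ℝ s) hks (convex_convexHull ℝ s)), ?_⟩
      classical
      intro t hts htm
      obtain rfl | ⟨x, hx⟩ := t.eq_empty_or_nonempty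
      · simp
      obtain h0 | h0 := (t.erase x).eq_empty_or_nonempty
      · rw [← Finset.insert_erase hx, h0]
        simpa using Or.inl (hts hx)
      · rw [← Finset.insert_erase hx, Finset.coe_insert, convexHull_insert (by exact_mod_cast h0)]
        refine Set.Subset.trans (convexJoin_mono (Set.singleton_subset_iff.2 (hts hx))
          (hkt _ (fun y hy => hts (Finset.mem_of_mem_erase (Finset.mem_coe.1 hy))) ?_))
          Set.subset_union_right
        rw [Finset.card_erase_of_mem hx]
        omega
  -- By Carathéodory, dimension plus one points suffice.
  obtain ⟨k, hk, hks, hkt⟩ := key (Module.finrank ℝ E + 1)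
  suffices h : convexHull ℝ s = k by rwa [h]
  refine Set.Subset.antisymm ?_ hks
  rw [convexHull_eq_union]
  refine Set.iUnion_subset fun t => Set.iUnion_subset fun hts => Set.iUnion_subset fun hai => ?_
  refine hkt t hts ?_
  have := hai.card_le_finrank_succ
  rw [Fintype.card_coe] at this
  exact this.trans (Nat.succ_le_succ (Submodule.finrank_le _))

/-- A point of the convex hull of a finite family is a convex combination of the family. -/
theorem exists_weights_of_mem_convexHull_image {ι E : Type*} [AddCommGroup E] [Module ℝ E]
    (a : ι → E) (J : Finset ι) {x : E} (hx : x ∈ convexHull ℝ (a '' J)) :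
    ∃ ν : ι → ℝ, (∀ t ∈ J, 0 ≤ ν t) ∧ ∑ t ∈ J, ν t = 1 ∧ ∑ t ∈ J, ν t • a t = x := by
  classical
  let C : Set E :=
    {x | ∃ ν : ι → ℝ, (∀ t ∈ J, 0 ≤ ν t) ∧ ∑ t ∈ J, ν t = 1 ∧ ∑ t ∈ J, ν t • a t = x}
  refine convexHull_min (t := C) ?_ ?_ hx
  · rintro _ ⟨t, ht, rfl⟩
    have ht' : t ∈ J := ht
    refine ⟨Pi.single t 1, fun i _ => ?_, ?_, ?_⟩
    · by_cases h : i = t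
      · subst h; simp
      · simp [h]
    · simp [Pi.single_apply, ht']
    · simp [Pi.single_apply, ht']
  · rintro _ ⟨ν, hν, hν1, rfl⟩ _ ⟨ω, hω, hω1, rfl⟩ p q hp hq hpq
    refine ⟨fun t => p * ν t + q * ω t, fun t ht => ?_, ?_, ?_⟩
    · exact add_nonneg (mul_nonneg hp (hν t ht)) (mul_nonneg hq (hω t ht))
    · rw [Finset.sum_add_distrib, ← Finset.mul_sum, ← Finset.mul_sum, hν1, hω1]
      simpa using hpq
    · simp only [add_smul, mul_smul, Finset.sum_add_distrib, Finset.smul_sum]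

/-- If every point of a compact convex set `K` of vectors has a positive coordinate, then some
nonnegative combination of the coordinates is positive on `K`. -/
theorem exists_nonneg_weights_forall_sum_pos {ι : Type*} [Fintype ι] {K : Set (ι → ℝ)}
    (hK : IsCompact K) (hKc : Convex ℝ K) (hpos : ∀ k ∈ K, ∃ i, 0 < k i) :
    ∃ μ : ι → ℝ, (∀ i, 0 ≤ μ i) ∧ ∀ k ∈ K, 0 < ∑ i, μ i * k i := by
  classical
  have hdisj : Disjoint (Set.Iic (0 : ι → ℝ)) K := by
    rw [Set.disjoint_left]
    intro k hk0 hk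
    obtain ⟨i, hi⟩ := hpos k hk
    exact absurd (hk0 i) (not_le.2 hi)
  obtain ⟨f, u, v, hu, huv, hv⟩ := geometric_hahn_banach_closed_compact
    (convex_Iic (0 : ι → ℝ)) isClosed_Iic hKc hK hdisj
  have hu0 : 0 < u := by simpa using hu 0 (Set.mem_Iic.2 le_rfl)
  have hf : ∀ k : ι → ℝ, f k = ∑ i, f (Pi.single i 1) * k i := by
    intro k
    conv_lhs => rw [pi_eq_sum_univ' k]
    rw [map_sum]
    refine Finset.sum_congr rfl fun i _ => ?_
    rw [map_smul, smul_eq_mul, mul_comm]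
  refine ⟨fun i => f (Pi.single i 1), fun i => ?_, fun k hk => ?_⟩
  -- A negative coefficient would let a point of the nonpositive orthant reach the value `u`, which
  -- bounds `f` strictly there.
  · by_contra! hneg
    have h := hu ((-(u / -f (Pi.single i 1))) • Pi.single i 1) (by
      intro j
      have : 0 ≤ u / -f (Pi.single i 1) := by
        apply div_nonneg hu0.le; linarith
      by_cases hj : j = i
      · subst hj; simpa using this
      · simp [hj])
    rw [map_smul, smul_eq_mul] at h
    have h2 : -(u / -f (Pi.single i 1)) * f (Pi.single i 1) = u := by
      have := hneg.ne
      field_simp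
    linarith
  · rw [← hf]
    linarith [hv k hk]

/-- A system of nonnegative weights making a combination of coordinates positive on `K` can be
chosen on a support `J'` on which no nontrivial nonnegative combination is nonpositive on `K`. -/
theorem exists_minimal_support {ι : Type*} (K : Set (ι → ℝ)) (J : Finset ι) (μ : ι → ℝ)
    (hμ : ∀ t ∈ J, 0 ≤ μ t) (hpos : ∀ k ∈ K, 0 < ∑ t ∈ J, μ t * k t) :
    ∃ (J' : Finset ι) (μ' : ι → ℝ), (∀ t ∈ J', 0 ≤ μ' t) ∧
      (∀ k ∈ K, 0 < ∑ t ∈ J', μ' t * k t) ∧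
      ∀ ν : ι → ℝ, (∀ t ∈ J', 0 ≤ ν t) → (∃ t ∈ J', 0 < ν t) →
        ∃ k ∈ K, 0 < ∑ t ∈ J', ν t * k t := by
  classical
  induction J using Finset.strongInduction generalizing μ with
  | H J ih =>
    by_cases hJ : ∀ ν : ι → ℝ, (∀ t ∈ J, 0 ≤ ν t) → (∃ t ∈ J, 0 < ν t) →
        ∃ k ∈ K, 0 < ∑ t ∈ J, ν t * k t
    · exact ⟨J, μ, hμ, hpos, hJ⟩
    push Not at hJ
    obtain ⟨ν, hν, ⟨t₁, ht₁, hνt₁⟩, hK⟩ := hJ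
    -- Ratio test: `r` is the largest multiple of `ν` that can be subtracted from `μ` keeping the
    -- weights nonnegative. The index `t₀` then drops out, and positivity on `K` survives since the
    -- `ν`-combination is nonpositive there.
    obtain ⟨t₀, ht₀, hmin⟩ := Finset.exists_min_image (J.filter fun t => 0 < ν t)
      (fun t => μ t / ν t) ⟨t₁, Finset.mem_filter.2 ⟨ht₁, hνt₁⟩⟩
    rw [Finset.mem_filter] at ht₀
    obtain ⟨ht₀J, ht₀ν⟩ := ht₀
    set r := μ t₀ / ν t₀ with hr
    have hr0 : 0 ≤ r := div_nonneg (hμ _ ht₀J) ht₀ν.le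
    have hr1 : μ t₀ - r * ν t₀ = 0 := by
      rw [hr]; field_simp; ring
    refine ih (J.erase t₀) (Finset.erase_ssubset ht₀J) (fun t => μ t - r * ν t) ?_ ?_
    · intro t ht
      have htJ := Finset.mem_of_mem_erase ht
      obtain h | h := (hν t htJ).eq_or_lt
      · simpa [← h] using hμ t htJ
      · have := hmin t (Finset.mem_filter.2 ⟨htJ, h⟩)
        rw [le_div_iff₀ h] at this
        linarith
    · intro k hk
      have h1 : ∑ t ∈ J.erase t₀, (μ t - r * ν t) * k t =
          ∑ t ∈ J, (μ t - r * ν t) * k t := by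
        rw [← Finset.add_sum_erase J _ ht₀J, hr1]; simp
      have h2 : ∑ t ∈ J, (μ t - r * ν t) * k t =
          ∑ t ∈ J, μ t * k t - r * ∑ t ∈ J, ν t * k t := by
        rw [Finset.mul_sum, ← Finset.sum_sub_distrib]
        exact Finset.sum_congr rfl fun t _ => by ring
      rw [h1, h2]
      nlinarith [hpos k hk, hK k hk]

end ConvexGeometry

/-! ### Coordinates, dual norm and separation -/

namespace RnWith

variable {n : ℕ} {N : RnNorm n}

/-- The coordinate map as a linear equivalence. -/
def coordsEquiv (N : RnNorm n) : RnWith N ≃ₗ[ℝ] (Fin n → ℝ) where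
  toFun := coords
  invFun x := x
  map_add' _ _ := rfl
  map_smul' _ _ := rfl
  left_inv _ := rfl
  right_inv _ := rfl

instance : FiniteDimensional ℝ (RnWith N) :=
  LinearEquiv.finiteDimensional (coordsEquiv N).symm

@[fun_prop]
theorem continuous_coords : Continuous (coords : RnWith N → Fin n → ℝ) :=
  (coordsEquiv N).toLinearMap.continuous_of_finiteDimensional

theorem coords_sub (x y : RnWith N) : (x - y).coords = x.coords - y.coords := rfl

theorem coords_add (x y : RnWith N) : (x + y).coords = x.coords + y.coords := rfl

theorem coords_smul (c : ℝ) (x : RnWith N) : (c • x).coords = c • x.coords := rfl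

theorem coords_zero : (0 : RnWith N).coords = 0 := rfl

end RnWith

open RnWith

theorem abs_dotProduct_le_dualNorm_mul {n : ℕ} (N : RnNorm n) (u : Fin n → ℝ) (x : RnWith N) :
    ENNReal.ofReal |u ⬝ᵥ x.coords| ≤ dualNorm N u * ENNReal.ofReal ‖x‖ := by
  obtain rfl | hx := eq_or_ne x 0
  · simp [coords_zero]
  have hx' : 0 < ‖x‖ := norm_pos_iff.2 hx
  have h : ENNReal.ofReal |u ⬝ᵥ (‖x‖⁻¹ • x).coords| ≤ dualNorm N u :=
    le_iSup₂_of_le (‖x‖⁻¹ • x) (by rw [norm_smul, norm_inv, norm_norm, inv_mul_cancel₀ hx'.ne'])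
      le_rfl
  calc ENNReal.ofReal |u ⬝ᵥ x.coords|
      = ENNReal.ofReal |u ⬝ᵥ (‖x‖⁻¹ • x).coords| * ENNReal.ofReal ‖x‖ := by
        rw [← ENNReal.ofReal_mul (abs_nonneg _), coords_smul, dotProduct_smul, smul_eq_mul, abs_mul,
          abs_of_pos (inv_pos.2 hx')]
        congr 1
        field_simp
    _ ≤ _ := by gcongr

theorem dualNorm_zero_sub {n : ℕ} (N : RnNorm n) (u : Fin n → ℝ) :
    dualNorm N (0 - u) = dualNorm N u := by
  simp [dualNorm]

/-- Strict separation of the origin from the convex hull of a compact set of vectors. -/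
theorem exists_forall_dotProduct_le_neg_one {n : ℕ} {S : Set (Fin n → ℝ)} (hS : IsCompact S)
    (h0 : (0 : Fin n → ℝ) ∉ convexHull ℝ S) : ∃ d : Fin n → ℝ, ∀ v ∈ S, v ⬝ᵥ d ≤ -1 := by
  classical
  obtain ⟨f, u, hu0, hu⟩ := geometric_hahn_banach_point_closed (convex_convexHull ℝ S)
    hS.isCompact_convexHull_of_finiteDimensional.isClosed h0
  rw [map_zero] at hu0
  have hf : ∀ k : Fin n → ℝ, f k = k ⬝ᵥ fun i => f (Pi.single i 1) := by
    intro k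
    conv_lhs => rw [pi_eq_sum_univ' k]
    simp [map_sum, dotProduct]
  refine ⟨(-u⁻¹) • fun i => f (Pi.single i 1), fun v hv => ?_⟩
  rw [dotProduct_smul, ← hf, smul_eq_mul, neg_mul, neg_le_neg_iff]
  have := hu v (subset_convexHull ℝ S hv)
  rw [← div_eq_inv_mul, le_div_iff₀ hu0]
  linarith

/-! ### The two inequalities for the Hoffman constant -/

section Hoffman

variable {n : ℕ} (N : RnNorm n) {T : Type*} [MetricSpace T] (a : T → Fin n → ℝ)

theorem inv_dualDist_le_of_isHoffmanConstant [CompactSpace T] (ha : Continuous a) {κ : ℝ≥0}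
    (hκ : IsHoffmanConstant (fun b : C(T, ℝ) => feasibleSet N a b) κ) {J : Set T}
    (hJ : IsCompact J) (h0 : (0 : Fin n → ℝ) ∉ convexHull ℝ (a '' J)) :
    (dualDist N 0 (convexHull ℝ (a '' J)))⁻¹ ≤ κ := by
  obtain ⟨d, hd⟩ := exists_forall_dotProduct_le_neg_one (hJ.image ha) h0
  -- Equals `-1` on `J`, keeps `d` feasible, and is nowhere below `-1`.
  let b : C(T, ℝ) := ⟨fun t => max (-1) (a t ⬝ᵥ d), by fun_prop⟩
  have hdist : Metric.infEDist b {z : C(T, ℝ) | (0 : RnWith N) ∈ feasibleSet N a z} ≤ 1 := by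
    let z : C(T, ℝ) := ⟨fun t => max 0 (b t), by fun_prop⟩
    have hz : z ∈ {z : C(T, ℝ) | (0 : RnWith N) ∈ feasibleSet N a z} := by
      intro t
      simp [coords_zero, z]
    refine (Metric.infEDist_le_edist_of_mem hz).trans ?_
    rw [edist_dist]
    refine ENNReal.ofReal_le_one.2 ((ContinuousMap.dist_le zero_le_one).2 fun t => ?_)
    have h1 : -1 ≤ b t := le_max_left _ _
    change |b t - max 0 (b t)| ≤ 1
    rw [abs_le]
    constructor <;> rcases max_cases 0 (b t) with h | h <;> linarith
  have hfeas : (feasibleSet N a b).Nonempty :=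
    ⟨(coordsEquiv N).symm d, fun t => le_max_right (-1) (a t ⬝ᵥ d)⟩
  have hle : Metric.infEDist (0 : RnWith N) (feasibleSet N a b) ≤ κ :=
    (hκ 0 b hfeas).trans (mul_le_of_le_one_right' hdist)
  refine le_trans ?_ hle
  rw [Metric.le_infEDist]
  intro x hx
  rw [ENNReal.inv_le_iff_inv_le, dualDist, le_iInf₂_iff]
  intro u hu
  rw [dualNorm_zero_sub]
  have hux : u ⬝ᵥ x.coords ≤ -1 := by
    have hconv : Convex ℝ {v : Fin n → ℝ | v ⬝ᵥ x.coords ≤ -1} := by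
      refine convex_halfSpace_le ⟨fun v w => add_dotProduct v w _, fun c v => ?_⟩ _
      rw [smul_dotProduct]
    refine convexHull_min ?_ hconv hu
    rintro _ ⟨t, ht, rfl⟩
    refine (hx t).trans ?_
    change max (-1) (a t ⬝ᵥ d) ≤ -1
    exact max_le le_rfl (hd _ ⟨t, ht, rfl⟩)
  have h1 : 1 ≤ dualNorm N u * ENNReal.ofReal ‖x‖ := by
    refine le_trans ?_ (abs_dotProduct_le_dualNorm_mul N u x)
    rw [ENNReal.one_le_ofReal, le_abs]
    right; linarith
  rw [edist_dist, dist_zero_left]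
  rw [mul_comm] at h1
  refine (ENNReal.inv_le_iff_le_mul (fun _ h => ?_) fun h => absurd h ENNReal.ofReal_ne_top).2 h1
  rw [h, zero_mul] at h1
  exact absurd h1 (by simp)

/-- If the closed ball of radius `ρ` around `x` contains no feasible point, then a convex
combination of finitely many constraints, none of whose convex combinations has zero gradient, is
violated on the whole ball. -/
theorem exists_violated_combination {b : C(T, ℝ)} (hb : (feasibleSet N a b).Nonempty)
    (x : RnWith N) {ρ : ℝ} (hρ : 0 ≤ ρ) (hdisj : ∀ z ∈ feasibleSet N a b, ρ < dist z x) :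
    ∃ (J : Finset T) (μ : T → ℝ), (0 : Fin n → ℝ) ∉ convexHull ℝ (a '' J) ∧
      (∀ t ∈ J, 0 ≤ μ t) ∧ ∑ t ∈ J, μ t = 1 ∧
      ∀ z ∈ Metric.closedBall x ρ, 0 < ∑ t ∈ J, μ t * (a t ⬝ᵥ z.coords - b t) := by
  classical
  have : ProperSpace (RnWith N) := FiniteDimensional.proper_real _
  obtain ⟨J₀, hJ₀⟩ := (isCompact_closedBall x ρ).elim_finite_subfamily_closed
    (fun t => {z : RnWith N | a t ⬝ᵥ z.coords ≤ b t})
    (fun t => isClosed_le (by fun_prop) continuous_const) (by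
      ext z
      simp only [Set.mem_inter_iff, Set.mem_iInter, Set.mem_empty_iff_false, iff_false, not_and]
      intro hz hz'
      exact absurd (Metric.mem_closedBall.1 hz) (not_le.2 (hdisj z hz')))
  let G : RnWith N → T → ℝ := fun z t => a t ⬝ᵥ z.coords - b t
  let G₀ : RnWith N → J₀ → ℝ := fun z t => a t ⬝ᵥ z.coords - b t
  have hG₀ : Continuous G₀ := by fun_prop
  have hconv : Convex ℝ (G₀ '' Metric.closedBall x ρ) := by
    rintro _ ⟨y, hy, rfl⟩ _ ⟨z, hz, rfl⟩ p q hp hq hpq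
    refine ⟨p • y + q • z, convex_closedBall x ρ hy hz hp hq hpq, ?_⟩
    ext t
    have : b t = p * b t + q * b t := by rw [← add_mul, hpq, one_mul]
    simp only [G₀, coords_add, coords_smul, dotProduct_add, dotProduct_smul, smul_eq_mul,
      Pi.add_apply, Pi.smul_apply]
    linear_combination -this
  obtain ⟨μ₀, hμ₀, hpos₀⟩ := exists_nonneg_weights_forall_sum_pos
    ((isCompact_closedBall x ρ).image hG₀) hconv (by
      rintro _ ⟨z, hz, rfl⟩
      by_contra! hcon
      have : z ∈ Metric.closedBall x ρ ∩ ⋂ t ∈ J₀, {z : RnWith N | a t ⬝ᵥ z.coords ≤ b t} := by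
        refine ⟨hz, Set.mem_iInter₂.2 fun t ht => ?_⟩
        exact sub_nonpos.1 (hcon ⟨t, ht⟩)
      rw [hJ₀] at this
      exact this)
  obtain ⟨J, μ, hμ, hpos, hmin⟩ := exists_minimal_support (G '' Metric.closedBall x ρ) J₀
    (fun t => if h : t ∈ J₀ then μ₀ ⟨t, h⟩ else 0) (fun t ht => by simpa [ht] using hμ₀ ⟨t, ht⟩) (by
      rintro _ ⟨z, hz, rfl⟩
      have := hpos₀ _ ⟨z, hz, rfl⟩
      rw [← Finset.sum_attach]
      simpa [G, G₀] using this)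
  have hxB : x ∈ Metric.closedBall x ρ := Metric.mem_closedBall_self hρ
  have hsum : 0 < ∑ t ∈ J, μ t := by
    refine (Finset.sum_nonneg hμ).lt_of_ne fun h => ?_
    have h0 := (Finset.sum_eq_zero_iff_of_nonneg hμ).1 h.symm
    have := hpos _ ⟨x, hxB, rfl⟩
    rw [Finset.sum_eq_zero fun t ht => by rw [h0 t ht, zero_mul]] at this
    exact this.false
  refine ⟨J, fun t => (∑ t ∈ J, μ t)⁻¹ * μ t, ?_, ?_, ?_, ?_⟩
  · intro h0
    obtain ⟨ν, hν, hν1, hν0⟩ := exists_weights_of_mem_convexHull_image a J h0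
    -- With zero gradient the `ν`-combination of residuals is constant in `z`: minimality makes it
    -- positive, a feasible point makes it nonpositive.
    have hsumν : ∀ z : RnWith N, ∑ t ∈ J, ν t * G z t = -∑ t ∈ J, ν t * b t := by
      intro z
      have h : ∑ t ∈ J, ν t * (a t ⬝ᵥ z.coords) = 0 := by
        have := congrArg (fun v => v ⬝ᵥ z.coords) hν0
        simpa [sum_dotProduct, smul_dotProduct] using this
      simp only [G, mul_sub, Finset.sum_sub_distrib, h, zero_sub]
    obtain ⟨y, hy⟩ := hb
    obtain ⟨_, ⟨z, -, rfl⟩, hz⟩ := hmin ν hν (by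
      by_contra! hcon
      have := Finset.sum_nonpos hcon
      linarith)
    have h2 : ∑ t ∈ J, ν t * G y t ≤ 0 :=
      Finset.sum_nonpos fun t ht => mul_nonpos_of_nonneg_of_nonpos (hν t ht) (sub_nonpos.2 (hy t))
    rw [hsumν] at h2 hz
    linarith
  · exact fun t ht => mul_nonneg (inv_nonneg.2 hsum.le) (hμ t ht)
  · rw [← Finset.mul_sum, inv_mul_cancel₀ hsum.ne']
  · intro z hz
    simp only [mul_assoc]
    rw [← Finset.mul_sum]
    exact mul_pos (inv_pos.2 hsum) (hpos _ ⟨z, hz, rfl⟩)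

theorem isHoffmanConstant_of_inv_dualDist_le [CompactSpace T] (ha : Continuous a) {κ : ℝ≥0}
    (hκ : ∀ J : Set T, IsCompact J → (0 : Fin n → ℝ) ∉ convexHull ℝ (a '' J) →
      (dualDist N 0 (convexHull ℝ (a '' J)))⁻¹ ≤ κ) :
    IsHoffmanConstant (fun b : C(T, ℝ) => feasibleSet N a b) κ := by
  intro x b hb
  set e := Metric.infEDist b {z : C(T, ℝ) | x ∈ feasibleSet N a z} with he
  have he_top : e ≠ ⊤ := by
    let z : C(T, ℝ) := ⟨fun t => a t ⬝ᵥ x.coords, by fun_prop⟩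
    have hz : z ∈ {z : C(T, ℝ) | x ∈ feasibleSet N a z} := fun t => le_rfl
    exact ne_top_of_le_ne_top (edist_ne_top b z) (Metric.infEDist_le_edist_of_mem hz)
  -- Residuals at `x` are bounded by the distance to any parameter that admits `x`.
  have he_le : ∀ t, a t ⬝ᵥ x.coords - b t ≤ e.toReal := by
    intro t
    rw [← ENNReal.ofReal_le_iff_le_toReal he_top, he, Metric.le_infEDist]
    intro z hz
    rw [edist_dist]
    refine ENNReal.ofReal_le_ofReal ?_
    have h1 := hz t
    have h2 := ContinuousMap.dist_apply_le_dist (f := b) (g := z) t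
    rw [Real.dist_eq, abs_le] at h2
    linarith [h2.1]
  by_contra! hlt
  obtain ⟨ρ, hρ1, hρ2⟩ := ENNReal.lt_iff_exists_nnreal_btwn.1 hlt
  have hρ0 : 0 < (ρ : ℝ) := by exact_mod_cast pos_of_gt hρ1
  obtain ⟨J, μ, h0, hμ, hμ1, hpos⟩ := exists_violated_combination N a hb x hρ0.le (by
    intro z hz
    have h := hρ2.trans_le (Metric.infEDist_le_edist_of_mem hz)
    rw [edist_comm, edist_nndist, ENNReal.coe_lt_coe] at h
    exact_mod_cast h)
  set u := ∑ t ∈ J, μ t • a t with hu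
  have hu_mem : u ∈ convexHull ℝ (a '' J) :=
    (convex_convexHull ℝ _).sum_mem hμ hμ1 fun t ht => subset_convexHull ℝ _ ⟨t, ht, rfl⟩
  have hball : ∀ w : RnWith N, ‖w‖ ≤ 1 → ρ * (u ⬝ᵥ w.coords) ≤ e.toReal := by
    intro w hw
    have h := hpos (x - (ρ : ℝ) • w) (by
      rw [Metric.mem_closedBall, dist_eq_norm, sub_sub_cancel_left, norm_neg, norm_smul,
        Real.norm_of_nonneg hρ0.le]
      exact mul_le_of_le_one_right hρ0.le hw)
    have h2 : ∑ t ∈ J, μ t * (a t ⬝ᵥ (x - (ρ : ℝ) • w).coords - b t) =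
        ∑ t ∈ J, μ t * (a t ⬝ᵥ x.coords - b t) - ρ * (u ⬝ᵥ w.coords) := by
      rw [hu, sum_dotProduct, Finset.mul_sum, ← Finset.sum_sub_distrib]
      refine Finset.sum_congr rfl fun t _ => ?_
      rw [coords_sub, coords_smul, dotProduct_sub, dotProduct_smul, smul_dotProduct, smul_eq_mul,
        smul_eq_mul]
      ring
    have h3 : ∑ t ∈ J, μ t * (a t ⬝ᵥ x.coords - b t) ≤ ∑ t ∈ J, μ t * e.toReal :=
      Finset.sum_le_sum fun t ht => mul_le_mul_of_nonneg_left (he_le t) (hμ t ht)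
    rw [← Finset.sum_mul, hμ1, one_mul] at h3
    linarith
  have hdual : dualNorm N u ≤ e / ρ := by
    refine iSup₂_le fun w hw => ?_
    rw [ENNReal.le_div_iff_mul_le (Or.inl (by exact_mod_cast hρ0.ne'))
      (Or.inl ENNReal.coe_ne_top), ← ENNReal.ofReal_coe_nnreal, ← ENNReal.ofReal_mul (abs_nonneg _)]
    refine ENNReal.ofReal_le_of_le_toReal ?_
    nth_rw 1 [← abs_of_pos hρ0]
    rw [← abs_mul, abs_le]
    have h1 := hball w hw
    have h2 := hball (-w) (by rwa [norm_neg])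
    have h3 : u ⬝ᵥ (-w).coords = -(u ⬝ᵥ w.coords) := dotProduct_neg u w.coords
    rw [h3] at h2
    constructor <;> linarith
  have hinv : (κ : ℝ≥0∞)⁻¹ ≤ e / ρ := by
    refine le_trans ?_ hdual
    rw [ENNReal.inv_le_iff_inv_le]
    refine le_trans (ENNReal.inv_le_inv.2 ?_) (hκ J J.finite_toSet.isCompact h0)
    exact (iInf₂_le u hu_mem).trans (dualNorm_zero_sub N u).le
  rw [ENNReal.le_div_iff_mul_le (Or.inl (by exact_mod_cast hρ0.ne')) (Or.inl ENNReal.coe_ne_top),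
    mul_comm, ← div_eq_mul_inv] at hinv
  -- For `κ = 0`, `ρ / 0 = ⊤` would force `e = ⊤`.
  obtain hk | hk := eq_or_ne (κ : ℝ≥0∞) 0
  · rw [hk, ENNReal.div_zero (by exact_mod_cast hρ0.ne')] at hinv
    exact he_top (top_le_iff.1 hinv)
  · rw [ENNReal.div_le_iff hk ENNReal.coe_ne_top, mul_comm] at hinv
    exact absurd hρ1 (not_lt.2 hinv)

end Hoffman

theorem mainTheorem2 {n : ℕ} (N : RnNorm n) {T : Type*} [MetricSpace T] [CompactSpace T]
    (a : T → Fin n → ℝ) (ha : Continuous a) :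
    globalHoffman (fun b : C(T, ℝ) => feasibleSet N a b) =
      ⨆ J : Set T, ⨆ _ : IsCompact J, ⨆ _ : (0 : Fin n → ℝ) ∉ convexHull ℝ (a '' J),
        (dualDist N 0 (convexHull ℝ (a '' J)))⁻¹ := by
  refine le_antisymm (le_of_forall_ge fun c hc => ?_) ?_
  · obtain rfl | hc_top := eq_or_ne c ⊤
    · exact le_top
    lift c to ℝ≥0 using hc_top
    refine iInf₂_le c (isHoffmanConstant_of_inv_dualDist_le N a ha fun J hJ h0 => ?_)
    simp only [iSup_le_iff] at hc
    exact hc J hJ h0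
  · refine le_iInf₂ fun κ hκ => iSup₂_le fun J hJ => iSup_le fun h0 => ?_
    exact inv_dualDist_le_of_isHoffmanConstant N a ha hκ hJ h0
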